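/- Let $a\ge 1$ be a square-free integer and $b$ a prime such that the Legendre symbols satisfy $\left(\frac{a}{b}\right)=-1$, $\left(\frac{-1}{b}\right)=1$ and $\left(\frac{-3}{b}\right)=1$. Let $\mathfrak A=\left(\frac{a,b}{\mathbb Q}\right)$ be the quaternion algebra over $\mathbb Q$ with basis $1,\omega,\Omega,\omega\Omega$, where $\omega^2=a$, $\Omega^2=b$, $\omega\Omega=-\Omega\omega$. Write its elements as $\alpha=\xi+\eta\,\Omega$ with $\xi,\eta\in\mathbb F=\mathbb Q(\omega)$, and identify $\mathbb F$ with $\mathbb Q(\sqrt a)\subset\mathbb R$ by $\omega\mapsto\sqrt a>0$. Let $\xi\mapsto\xi'$ be the nontrivial automorphism of $\mathbb F$, and put $\overline\alpha=\xi'-\eta\,\Omega$, $\mathrm{Tr}(\alpha)=\alpha+\overline\alpha$, $\mathrm N(\alpha)=\alpha\overline\alpha$. Let $R$ be an order of $\mathfrak A$, that is, a subring containing $1$ whose elements all have integral trace and norm, and which is generated as an additive group by four elements that are linearly independent over $\mathbb Q$. Let $$\Gamma_R=\left\{\begin{pmatrix}\xi&\eta\\ b\,\eta'&\xi'\end{pmatrix}\;:\;\xi+\eta\,\Omega\in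 R,\ \mathrm N(\xi+\eta\,\Omega)=1\right\}\subset \mathrm{SL}(2,\mathbb R)\subset\mathrm{SL}(2,\mathbb C),$$ acting on $\mathbb H^3=\{z+t\,\mathbf j : z\in\mathbb C,\ t>0\}$ (inside the Hamilton quaternions) by the Poincaré extension $\begin{pmatrix}p&q\\ r&s\end{pmatrix}\cdot x=(px+q)(rx+s)^{-1}$, and let $\pi_R:\mathbb H^3\to X_R=\Gamma_R\backslash\mathbb H^3$ be the canonical projection onto the quotient space. (Under these conditions $\mathfrak A$ is an indefinite division algebra and $\Gamma_R/\{\pm1\}$ acts freely on $\mathbb H^3$, so $X_R$ is a hyperbolic manifold, called a $(K_1^S)$-manifold.) The itgs (imbedded totally geodesic surfaces) of $\mathbb H^3$ are the half-planes orthogonal to $\mathbb C$, i.e. the sets $\{z+t\,\mathbf j : z\in D,\ t>0\}$ with $D$ a real line of $\mathbb C$, and the half-spheres centred on $\mathbb C$, i.e. the sets $\{z+t\,\mathbf j : t>0,\ |z-c|^2+t^2=r^2\}$ with $c\in\mathbb C$ and $r>0$. An itgs $S$ is called closed for $\Gamma_R$ if its projection $\pi_R(S)$ in $X_R$ is compact.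 Then the half-plane $P^{o}=\mathbb R\oplus\mathbb R_+^*\,\mathbf j=\{z+t\,\mathbf j : z\in\mathbb R,\ t>0\}$ is closed for $\Gamma_R$, and it is the only itgs of $\mathbb H^3$ that is closed for $\Gamma_R$. In particular, the projection of $P^{o}$ in $X_R$ is compact. -/

import Mathlib

open scoped Quaternion ComplexConjugate

noncomputable section

namespace QuatHyp

/-! Hyperbolic three-space and the Poincare extension. -/

/-- The upper half-space model: pairs `(z, t)` with `z` complex and `t > 0`. -/
def H3 : Type := {p : ℂ × ℝ // 0 < p.2}

namespace H3

instance : TopologicalSpace H3 := inferInstanceAs (TopologicalSpace {p : ℂ × ℝ // 0 < p.2})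

/-- The horizontal coordinate `z` of a point `z + t j`. -/
def z (x : H3) : ℂ := x.1.1

/-- The height `t` of a point `z + t j`. -/
def t (x : H3) : ℝ := x.1.2

theorem t_pos (x : H3) : 0 < x.t := x.2

theorem ext' {x y : H3} (hz : x.z = y.z) (ht : x.t = y.t) : x = y :=
  Subtype.ext (Prod.ext hz ht)

/-- The Hamilton quaternion `z + t j`. -/
def toQuat (x : H3) : ℍ[ℝ] := ⟨x.z.re, x.z.im, x.t, 0⟩

@[simp] theorem re_toQuat (x : H3) : x.toQuat.re = x.z.re := rfl
@[simp] theorem imI_toQuat (x : H3) : x.toQuat.imI = x.z.im := rfl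
@[simp] theorem imJ_toQuat (x : H3) : x.toQuat.imJ = x.t := rfl
@[simp] theorem imK_toQuat (x : H3) : x.toQuat.imK = 0 := rfl

theorem toQuat_injective : Function.Injective toQuat := by
  intro x y h
  have h1 := congrArg QuaternionAlgebra.re h
  have h2 := congrArg QuaternionAlgebra.imI h
  have h3 := congrArg QuaternionAlgebra.imJ h
  exact ext' (Complex.ext h1 h2) h3

end H3

/-- `|c z + d|^2 + |c|^2 t^2`, where `(c, d)` is the lower row of `γ`. -/
def den (γ : Matrix.SpecialLinearGroup (Fin 2) ℂ) (x : H3) : ℝ :=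
  Complex.normSq (γ.1 1 0 * x.z + γ.1 1 1) + Complex.normSq (γ.1 1 0) * x.t ^ 2

theorem den_pos (γ : Matrix.SpecialLinearGroup (Fin 2) ℂ) (x : H3) : 0 < den γ x := by
  have ht := x.t_pos
  by_cases hc : γ.1 1 0 = 0
  · have hdet := γ.2
    rw [Matrix.det_fin_two, hc] at hdet
    have hd : γ.1 1 1 ≠ 0 := by
      intro h
      simp [h] at hdet
    have := Complex.normSq_pos.2 hd
    simpa [den, hc] using this
  · have h1 := Complex.normSq_pos.2 hc
    have h2 := Complex.normSq_nonneg (γ.1 1 0 * x.z + γ.1 1 1)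
    unfold den
    positivity

/-- The Poincare extension of a complex unimodular matrix to `H3`, in coordinates. -/
def poincare (γ : Matrix.SpecialLinearGroup (Fin 2) ℂ) (x : H3) : H3 :=
  ⟨(((γ.1 0 0 * x.z + γ.1 0 1) * conj (γ.1 1 0 * x.z + γ.1 1 1)
      + γ.1 0 0 * conj (γ.1 1 0) * (x.t : ℂ) ^ 2) / (den γ x : ℂ),
    x.t / den γ x), div_pos x.t_pos (den_pos γ x)⟩


theorem toQuat_poincare_mul (γ : Matrix.SpecialLinearGroup (Fin 2) ℂ) (x : H3) :
    (poincare γ x).toQuat * ((γ.1 1 0 : ℍ[ℝ]) * x.toQuat + (γ.1 1 1 : ℍ[ℝ]))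
      = (γ.1 0 0 : ℍ[ℝ]) * x.toQuat + (γ.1 0 1 : ℍ[ℝ]) := by
  have hD := (den_pos γ x).ne'
  have hdet := γ.2
  rw [Matrix.det_fin_two] at hdet
  have hre := congrArg Complex.re hdet
  have him := congrArg Complex.im hdet
  have hz : (poincare γ x).z * (den γ x : ℂ) = (γ.1 0 0 * x.z + γ.1 0 1) *
      conj (γ.1 1 0 * x.z + γ.1 1 1) + γ.1 0 0 * conj (γ.1 1 0) * (x.t : ℂ) ^ 2 :=
    div_mul_cancel₀ _ (by exact_mod_cast hD)
  have ht : (poincare γ x).t * den γ x = x.t := div_mul_cancel₀ _ hD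
  have hzre := congrArg Complex.re hz
  have hzim := congrArg Complex.im hz
  obtain ⟨D, hden⟩ : ∃ D, D = den γ x := ⟨_, rfl⟩
  rw [← hden] at hD hzre hzim ht
  rw [den] at hden
  simp only [Complex.normSq_apply, pow_two, Complex.add_re, Complex.add_im, Complex.mul_re,
    Complex.mul_im, Complex.sub_re, Complex.sub_im, Complex.one_re, Complex.one_im,
    Complex.conj_re, Complex.conj_im, Complex.ofReal_re, Complex.ofReal_im]
    at hre him hzre hzim hden
  ext <;> apply mul_left_cancel₀ hD <;>
    simp only [Quaternion.re_mul, Quaternion.imI_mul, Quaternion.imJ_mul, Quaternion.imK_mul,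
      Quaternion.re_add, Quaternion.imI_add, Quaternion.imJ_add, Quaternion.imK_add,
      Quaternion.re_coeComplex, Quaternion.imI_coeComplex, Quaternion.imJ_coeComplex,
      Quaternion.imK_coeComplex, H3.re_toQuat, H3.imI_toQuat, H3.imJ_toQuat, H3.imK_toQuat]
  all_goals
    generalize (poincare γ x).z.re = p' at *
    generalize (poincare γ x).z.im = q' at *
    generalize (poincare γ x).t = t' at *
    clear hz hdet
    generalize (γ.1 0 0).re = a1 at *
    generalize (γ.1 0 0).im = a2 at *
    generalize (γ.1 0 1).re = b1 at *
    generalize (γ.1 0 1).im = b2 at *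
    generalize (γ.1 1 0).re = c1 at *
    generalize (γ.1 1 0).im = c2 at *
    generalize (γ.1 1 1).re = d1 at *
    generalize (γ.1 1 1).im = d2 at *
    generalize x.z.re = p at *
    generalize x.z.im = q at *
    generalize x.t = t at *
  · linear_combination (c1 * p - c2 * q + d1) * hzre - (c1 * q + c2 * p + d2) * hzim
      - c1 * t * ht + t ^ 2 * (c1 * hre + c2 * him) - (a1 * p - a2 * q + b1) * hden
  · linear_combination (c1 * p - c2 * q + d1) * hzim + (c1 * q + c2 * p + d2) * hzre
      + c2 * t * ht + t ^ 2 * (c1 * him - c2 * hre) - (a1 * q + a2 * p + b2) * hden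
  · linear_combination c1 * t * hzre - c2 * t * hzim + (c1 * p - c2 * q + d1) * ht
      - t * ((c1 * p - c2 * q + d1) * hre + (c1 * q + c2 * p + d2) * him) - a1 * t * hden
  · linear_combination c1 * t * hzim + c2 * t * hzre - (c1 * q + c2 * p + d2) * ht
      - t * ((c1 * p - c2 * q + d1) * him - (c1 * q + c2 * p + d2) * hre) - a2 * t * hden

theorem lower_ne_zero (γ : Matrix.SpecialLinearGroup (Fin 2) ℂ) (x : H3) :
    (γ.1 1 0 : ℍ[ℝ]) * x.toQuat + (γ.1 1 1 : ℍ[ℝ]) ≠ 0 := by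
  intro h
  have h0 := toQuat_poincare_mul γ x
  rw [h, mul_zero] at h0
  have hd := γ.2
  rw [Matrix.det_fin_two] at hd
  have e : ((γ.1 0 0 * γ.1 1 1 - γ.1 0 1 * γ.1 1 0 : ℂ) : ℍ[ℝ]) = 0 := by
    have k1 : (γ.1 1 1 : ℍ[ℝ]) = -((γ.1 1 0 : ℍ[ℝ]) * x.toQuat) := by
      rw [eq_neg_iff_add_eq_zero, add_comm, h]
    have k2 : (γ.1 0 1 : ℍ[ℝ]) = -((γ.1 0 0 : ℍ[ℝ]) * x.toQuat) := by
      rw [eq_neg_iff_add_eq_zero, add_comm, ← h0]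
    have k3 : (γ.1 0 0 * γ.1 1 1 - γ.1 0 1 * γ.1 1 0 : ℂ)
        = (γ.1 0 0 * γ.1 1 1 - γ.1 1 0 * γ.1 0 1 : ℂ) := by ring
    rw [k3, sub_eq_add_neg, Quaternion.coeComplex_add]
    have k4 : ((-(γ.1 1 0 * γ.1 0 1) : ℂ) : ℍ[ℝ]) = -((γ.1 1 0 : ℍ[ℝ]) * (γ.1 0 1 : ℍ[ℝ])) := by
      rw [← Quaternion.coeComplex_mul]; ext <;> simp
    rw [k4, Quaternion.coeComplex_mul, k1, k2, mul_neg, mul_neg, neg_neg, ← mul_assoc, ← mul_assoc,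
      ← Quaternion.coeComplex_mul, ← Quaternion.coeComplex_mul, mul_comm (γ.1 0 0)]
    simp
  rw [hd] at e
  simp at e

/-- The coordinate formula is the quaternionic one, `γ x = (a x + b) (c x + d)⁻¹`. -/
theorem toQuat_poincare (γ : Matrix.SpecialLinearGroup (Fin 2) ℂ) (x : H3) :
    (poincare γ x).toQuat = ((γ.1 0 0 : ℍ[ℝ]) * x.toQuat + (γ.1 0 1 : ℍ[ℝ])) *
      ((γ.1 1 0 : ℍ[ℝ]) * x.toQuat + (γ.1 1 1 : ℍ[ℝ]))⁻¹ :=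
  (eq_mul_inv_iff_mul_eq₀ (lower_ne_zero γ x)).2 (toQuat_poincare_mul γ x)

instance : MulAction (Matrix.SpecialLinearGroup (Fin 2) ℂ) H3 where
  smul := poincare
  one_smul x := by
    apply H3.toQuat_injective
    change (poincare 1 x).toQuat = x.toQuat
    rw [toQuat_poincare]
    simp
  mul_smul γ δ x := by
    apply H3.toQuat_injective
    change (poincare (γ * δ) x).toQuat = (poincare γ (poincare δ x)).toQuat
    rw [toQuat_poincare γ, eq_mul_inv_iff_mul_eq₀ (lower_ne_zero γ _)]
    have h1 := toQuat_poincare_mul (γ * δ) x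
    have h2 := toQuat_poincare_mul δ x
    have h3 := lower_ne_zero δ x
    apply mul_right_cancel₀ h3
    simp only [Matrix.SpecialLinearGroup.coe_mul, Matrix.mul_apply, Fin.sum_univ_two,
      Quaternion.coeComplex_add, Quaternion.coeComplex_mul] at h1
    simp only [mul_assoc, add_mul, h2] at h1 ⊢
    simp only [mul_add]
    simp only [mul_add] at h1
    convert h1 using 1 <;> abel

theorem smul_eq_poincare (γ : Matrix.SpecialLinearGroup (Fin 2) ℂ) (x : H3) :
    γ • x = poincare γ x := rfl

/-! Totally geodesic surfaces of `H3`. -/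

/-- The vertical half-plane over the real line of `ℂ` through `p` directed by `v`. -/
def halfPlane (p v : ℂ) : Set H3 := {x | ∃ s : ℝ, x.z = p + s * v}

/-- The half-sphere with centre `c` in `ℂ` and radius `r`. -/
def halfSphere (c : ℂ) (r : ℝ) : Set H3 := {x | ‖x.z - c‖ ^ 2 + x.t ^ 2 = r ^ 2}

/-- The itgs of `H3`: half-planes orthogonal to `ℂ` and half-spheres centred on `ℂ`. -/
def IsItgs (S : Set H3) : Prop :=
  (∃ p v : ℂ, v ≠ 0 ∧ S = halfPlane p v) ∨ (∃ (c : ℂ) (r : ℝ), 0 < r ∧ S = halfSphere c r)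

/-- The half-plane `P° = ℝ ⊕ ℝ₊* j`. -/
def realHalfPlane : Set H3 := {x | x.z.im = 0}

/-! Orders of the quaternion algebra of type `(a, b)` over `ℚ`, here with natural numbers `a`, `b`:
it is `ℍ[ℚ,a,b]` with `ω = i`, `Ω = j`, and `ω Ω = k`. -/

/-- The reduced trace `α + conj α`. -/
def qTrace {a b : ℕ} (α : ℍ[ℚ,(a : ℚ),(b : ℚ)]) : ℚ := (α + star α).re

/-- The reduced norm `α * conj α`. -/
def qNorm {a b : ℕ} (α : ℍ[ℚ,(a : ℚ),(b : ℚ)]) : ℚ := (α * star α).re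

theorem qTrace_eq {a b : ℕ} (α : ℍ[ℚ,(a : ℚ),(b : ℚ)]) : qTrace α = 2 * α.re := by
  simp [qTrace, two_mul]

theorem qNorm_eq {a b : ℕ} (α : ℍ[ℚ,(a : ℚ),(b : ℚ)]) :
    qNorm α = α.re ^ 2 - a * α.imI ^ 2 - b * (α.imJ ^ 2 - a * α.imK ^ 2) := by
  simp [qNorm]
  ring

/-- An order: a subring with integral norms and traces that is generated as an additive group by
four elements linearly independent over `ℚ`. -/
structure QuatOrder (a b : ℕ) extends Subring ℍ[ℚ,(a : ℚ),(b : ℚ)] where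
  norm_int : ∀ α ∈ carrier, ∃ n : ℤ, qNorm α = n
  trace_int : ∀ α ∈ carrier, ∃ n : ℤ, qTrace α = n
  generators : ∃ e : Fin 4 → ℍ[ℚ,(a : ℚ),(b : ℚ)], LinearIndependent ℚ e ∧
    carrier = (AddSubgroup.closure (Set.range e) : Set ℍ[ℚ,(a : ℚ),(b : ℚ)])

/-- The matrix with rows `(ξ, η)` and `(b η', ξ')` of `α = ξ + η Ω`, where `ξ`, `η` are in
`ℚ(√a) ⊆ ℝ` and `'` is the conjugation `√a ↦ -√a`; its entries are seen in `ℂ`. -/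
def phi {a b : ℕ} (α : ℍ[ℚ,(a : ℚ),(b : ℚ)]) : Matrix (Fin 2) (Fin 2) ℂ :=
  !![((α.re + α.imI * √(a : ℝ) : ℝ) : ℂ), ((α.imJ + α.imK * √(a : ℝ) : ℝ) : ℂ);
     ((b * (α.imJ - α.imK * √(a : ℝ)) : ℝ) : ℂ), ((α.re - α.imI * √(a : ℝ) : ℝ) : ℂ)]

theorem phi_one {a b : ℕ} : phi (1 : ℍ[ℚ,(a : ℚ),(b : ℚ)]) = 1 := by
  ext i j
  fin_cases i <;> fin_cases j <;> simp [phi]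

theorem phi_mul {a b : ℕ} (α β : ℍ[ℚ,(a : ℚ),(b : ℚ)]) : phi (α * β) = phi α * phi β := by
  have h : (√(a : ℝ)) ^ 2 = a := Real.sq_sqrt (Nat.cast_nonneg a)
  have h' : ((√(a : ℝ) : ℝ) : ℂ) ^ 2 = a := by rw [← Complex.ofReal_pow, h]; simp
  ext i j
  fin_cases i <;> fin_cases j <;> simp [phi, Matrix.mul_apply] <;> ring_nf <;> rw [h'] <;> ring

theorem det_phi {a b : ℕ} (α : ℍ[ℚ,(a : ℚ),(b : ℚ)]) : (phi α).det = (qNorm α : ℂ) := by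
  have h : (√(a : ℝ)) ^ 2 = a := Real.sq_sqrt (Nat.cast_nonneg a)
  have h' : ((√(a : ℝ) : ℝ) : ℂ) ^ 2 = a := by rw [← Complex.ofReal_pow, h]; simp
  rw [Matrix.det_fin_two, qNorm_eq]
  simp [phi]
  ring_nf
  rw [h']
  ring

theorem qNorm_star {a b : ℕ} (α : ℍ[ℚ,(a : ℚ),(b : ℚ)]) : qNorm (star α) = qNorm α := by
  simp [qNorm_eq]

theorem mul_star_eq {a b : ℕ} (α : ℍ[ℚ,(a : ℚ),(b : ℚ)]) :
    α * star α = algebraMap ℚ _ (qNorm α) := by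
  ext <;> simp [qNorm] <;> ring

theorem qNorm_mul {a b : ℕ} (α β : ℍ[ℚ,(a : ℚ),(b : ℚ)]) :
    qNorm (α * β) = qNorm α * qNorm β := by
  simp [qNorm_eq]
  ring

namespace QuatOrder

variable {a b : ℕ} (R : QuatOrder a b)

theorem star_mem {α : ℍ[ℚ,(a : ℚ),(b : ℚ)]} (h : α ∈ R.toSubring) : star α ∈ R.toSubring := by
  obtain ⟨n, hn⟩ := R.trace_int α h
  have e : star α = (n : ℍ[ℚ,(a : ℚ),(b : ℚ)]) - α := by
    rw [qTrace_eq] at hn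
    ext <;> simp
    linarith
  rw [e]
  exact sub_mem (intCast_mem _ n) h

/-- The group of the elements of norm one of the order, as a subgroup of `SL(2, ℂ)`. -/
def Gamma : Subgroup (Matrix.SpecialLinearGroup (Fin 2) ℂ) where
  carrier := {γ | ∃ α ∈ R.toSubring, qNorm α = 1 ∧ phi α = γ.1}
  one_mem' := ⟨1, one_mem _, by simp [qNorm_eq], phi_one⟩
  mul_mem' := by
    rintro γ δ ⟨α, hα, nα, eα⟩ ⟨β, hβ, nβ, eβ⟩
    exact ⟨α * β, mul_mem hα hβ, by rw [qNorm_mul, nα, nβ, one_mul], by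
      rw [phi_mul, eα, eβ]; rfl⟩
  inv_mem' := by
    rintro γ ⟨α, hα, nα, eα⟩
    refine ⟨star α, R.star_mem hα, by rw [qNorm_star, nα], ?_⟩
    have h1 : γ.1 * phi (star α) = 1 := by
      rw [← eα, ← phi_mul, mul_star_eq, nα, map_one, phi_one]
    have h2 : γ⁻¹.1 * γ.1 = 1 := congrArg Subtype.val (inv_mul_cancel γ)
    calc phi (star α) = γ⁻¹.1 * γ.1 * phi (star α) := by rw [h2, one_mul]
      _ = γ⁻¹.1 := by rw [mul_assoc, h1, mul_one]

/-- The quotient space `X_R` of `H3` by `Γ_R`, with the quotient topology. -/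
def X : Type := MulAction.orbitRel.Quotient R.Gamma H3

instance : TopologicalSpace R.X :=
  inferInstanceAs (TopologicalSpace (Quotient (MulAction.orbitRel R.Gamma H3)))

/-- The canonical projection of `H3` onto `X_R`. -/
def proj (x : H3) : R.X := Quotient.mk (MulAction.orbitRel R.Gamma H3) x

/-- An itgs of `H3` is closed for `Γ_R` if its projection in `X_R` is compact. -/
def IsClosedFor (S : Set H3) : Prop := IsItgs S ∧ IsCompact (R.proj '' S)

end QuatOrder

/-- The arithmetic conditions on `(a, b)` defining the class `(K_1^S)`. They force the quaternion
algebra to be a division algebra, and `Γ_R` modulo its centre `±1` to act freely on `H3` for every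
order `R`, so these two properties are not repeated. -/
structure IsK1S (a b : ℕ) [Fact b.Prime] : Prop where
  a_pos : 0 < a
  a_squarefree : Squarefree a
  legendre_a : legendreSym b a = -1
  legendre_neg_one : legendreSym b (-1) = 1
  legendre_neg_three : legendreSym b (-3) = 1

end QuatHyp

end

/-!
Two independent arguments show that `P°` is the only itgs with compact projection.

*Uniqueness.* The group `Γ_R` consists of real matrices, and `SL(2, ℝ)` preserves the function
`z + t j ↦ Im z / t`, which is `sinh` of the signed distance to `P°` (`slope_realSL_smul`). Hence
this function descends to a continuous function on `X_R`, and it is bounded on every itgs whose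
projection is compact (`QuatOrder.exists_abs_slope_le`). On a half-plane other than `P°`, and on any
half-sphere, it is unbounded near the boundary `t = 0`.

*Compactness of the projection of `P°`.* This is the cocompactness of the unit group of an order in
a division algebra. Since `SL(2, ℝ)` acts transitively on `P°`, it is enough to find a bound `B` such
that every `g ∈ SL(2, ℝ)` can be moved by an element `u` of norm one of `R` to a matrix `u g` with
entries at most `B` (`QuatOrder.exists_unit_mul_le`). The map `α ↦ α g` from the lattice `R` to the
real matrices has a determinant independent of `g`, so Minkowski's theorem gives a nonzero `β ∈ R`
for which the entries of `β g` are bounded independently of `g` (`QuatOrder.exists_mul_le`). The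
norm of `β` is then a bounded integer, nonzero because the algebra is a division algebra
(`eq_zero_of_qNorm_eq_zero`). Up to right multiplication by elements of norm one, `R` has only
finitely many elements of a given nonzero norm (`QuatOrder.exists_finite_norm_reps`); writing
`β = β₀ u` with `β₀` in a fixed finite set, `u g = β₀⁻¹ (β g)` is bounded.
-/

namespace QuatHyp

/-! ### Anisotropy of the norm form -/

/-- Since `a` is not a square modulo `b`, the form `x² - a y²` is divisible by `b` only when `x` and
`y` are, so a zero of the norm form is divisible by all powers of `b`. -/
theorem int_eq_zero_of_normForm {a b : ℕ} [Fact b.Prime] (h : legendreSym b a = -1) {x y z w : ℤ}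
    (e : x ^ 2 - a * y ^ 2 = b * (z ^ 2 - a * w ^ 2)) : x = 0 ∧ y = 0 ∧ z = 0 ∧ w = 0 := by
  have hb : (b : ℤ) ≠ 0 := by exact_mod_cast (Fact.out : b.Prime).ne_zero
  have key : ∀ n : ℕ, ∀ x y z w : ℤ, x ^ 2 - a * y ^ 2 = b * (z ^ 2 - a * w ^ 2) →
      (b : ℤ) ^ n ∣ x ∧ (b : ℤ) ^ n ∣ y ∧ (b : ℤ) ^ n ∣ z ∧ (b : ℤ) ^ n ∣ w := by
    intro n
    induction n with
    | zero => simp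
    | succ n ih =>
      intro x y z w e
      obtain ⟨⟨x, rfl⟩, ⟨y, rfl⟩⟩ := legendreSym.prime_dvd_of_eq_neg_one h (Dvd.intro _ e.symm)
      have e' : z ^ 2 - a * w ^ 2 = b * (x ^ 2 - a * y ^ 2) :=
        mul_left_cancel₀ hb (by linear_combination -e)
      obtain ⟨⟨z, rfl⟩, ⟨w, rfl⟩⟩ := legendreSym.prime_dvd_of_eq_neg_one h (Dvd.intro _ e'.symm)
      obtain ⟨h1, h2, h3, h4⟩ := ih x y z w (mul_left_cancel₀ hb (by linear_combination -e'))
      simp only [pow_succ']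
      exact ⟨mul_dvd_mul_left _ h1, mul_dvd_mul_left _ h2, mul_dvd_mul_left _ h3,
        mul_dvd_mul_left _ h4⟩
  have zero : ∀ x : ℤ, (∀ n : ℕ, (b : ℤ) ^ n ∣ x) → x = 0 := by
    intro x hx
    refine Int.eq_zero_of_abs_lt_dvd (hx x.natAbs) ?_
    rw [Int.abs_eq_natAbs]
    exact_mod_cast Nat.lt_pow_self (Fact.out : b.Prime).one_lt
  exact ⟨zero x fun n => (key n x y z w e).1, zero y fun n => (key n x y z w e).2.1,
    zero z fun n => (key n x y z w e).2.2.1, zero w fun n => (key n x y z w e).2.2.2⟩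

/-- The quaternion algebra is a division algebra. -/
theorem eq_zero_of_qNorm_eq_zero {a b : ℕ} [Fact b.Prime] (h : legendreSym b a = -1)
    {α : ℍ[ℚ,(a : ℚ),(b : ℚ)]} (hα : qNorm α = 0) : α = 0 := by
  obtain ⟨d, hd⟩ := IsLocalization.exist_integer_multiples_of_finset (nonZeroDivisors ℤ)
    ({α.re, α.imI, α.imJ, α.imK} : Finset ℚ)
  have hd0 : ((d : ℤ) : ℚ) ≠ 0 := by exact_mod_cast nonZeroDivisors.coe_ne_zero d
  obtain ⟨x, hx⟩ := hd α.re (by simp)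
  obtain ⟨y, hy⟩ := hd α.imI (by simp)
  obtain ⟨z, hz⟩ := hd α.imJ (by simp)
  obtain ⟨w, hw⟩ := hd α.imK (by simp)
  simp only [algebraMap_int_eq, eq_intCast, zsmul_eq_mul] at hx hy hz hw
  rw [qNorm_eq] at hα
  have e : x ^ 2 - a * y ^ 2 = b * (z ^ 2 - a * w ^ 2) := by
    have : (x : ℚ) ^ 2 - a * y ^ 2 = b * (z ^ 2 - a * w ^ 2) := by
      rw [hx, hy, hz, hw]
      linear_combination ((d : ℤ) : ℚ) ^ 2 * hα
    exact_mod_cast this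
  obtain ⟨rfl, rfl, rfl, rfl⟩ := int_eq_zero_of_normForm h e
  ext <;> simp_all

/-! ### Minkowski's theorem on linear forms -/

/-- **Minkowski's theorem on linear forms**, with a strict inequality on the determinant. -/
theorem exists_int_linear_forms_le {ι : Type*} [Fintype ι] [DecidableEq ι] (M : Matrix ι ι ℝ)
    (hM : M.det ≠ 0) {c : ℝ} (hc : 0 ≤ c) (h : |M.det| < c ^ Fintype.card ι) :
    ∃ m : ι → ℤ, m ≠ 0 ∧ ∀ i, |M.mulVec (fun j => (m j : ℝ)) i| ≤ c := by
  classical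
  let s : Set (ι → ℝ) := Matrix.toLin' M ⁻¹' Set.Icc (fun _ => -c) (fun _ => c)
  let L := (Submodule.span ℤ (Set.range (Pi.basisFun ℝ ι))).toAddSubgroup
  have : Countable L := inferInstanceAs (Countable (Submodule.span ℤ (Set.range (Pi.basisFun ℝ ι))))
  have hdet : LinearMap.det (Matrix.toLin' M) ≠ 0 := by rwa [LinearMap.det_toLin']
  have hvol : MeasureTheory.volume (ZSpan.fundamentalDomain (Pi.basisFun ℝ ι)) *
      2 ^ Module.finrank ℝ (ι → ℝ) < MeasureTheory.volume s := by
    rw [MeasureTheory.Measure.addHaar_preimage_linearMap _ hdet, LinearMap.det_toLin',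
      ZSpan.fundamentalDomain_pi_basisFun, Real.volume_Icc_pi, MeasureTheory.volume_pi_pi]
    simp only [Real.volume_Ico, sub_zero, ENNReal.ofReal_one, Finset.prod_const_one, one_mul,
      Module.finrank_fintype_fun_eq_card, Finset.prod_const, Finset.card_univ]
    rw [← ENNReal.ofReal_pow (by linarith), ← ENNReal.ofReal_mul (abs_nonneg _),
      show (2 : ENNReal) = ENNReal.ofReal 2 by simp, ← ENNReal.ofReal_pow (by norm_num),
      ENNReal.ofReal_lt_ofReal_iff_of_nonneg (by positivity), sub_neg_eq_add, ← two_mul, mul_pow,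
      abs_inv, mul_comm, mul_assoc]
    have := abs_pos.2 hM
    rw [lt_mul_iff_one_lt_right (by positivity), ← div_eq_mul_inv, one_lt_div this]
    exact h
  obtain ⟨⟨x, hxL⟩, hx0, hxs⟩ :=
    MeasureTheory.exists_ne_zero_mem_lattice_of_measure_mul_two_pow_lt_measure
      (ZSpan.isAddFundamentalDomain' (Pi.basisFun ℝ ι) MeasureTheory.volume)
      (s := s) (fun x hx => by
        simp only [s, Set.mem_preimage, Set.mem_Icc, Pi.le_def, map_neg, Pi.neg_apply] at hx ⊢
        exact ⟨fun i => neg_le_neg (hx.2 i), fun i => neg_le.1 (hx.1 i)⟩)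
      ((convex_Icc _ _).linear_preimage _) hvol
  have hmem := ((Pi.basisFun ℝ ι).mem_span_iff_repr_mem ℤ x).1 hxL
  choose m hm using hmem
  have hmx : (fun j => (m j : ℝ)) = x := by
    funext j
    simpa using hm j
  refine ⟨m, ?_, fun i => ?_⟩
  · rintro rfl
    apply hx0
    ext j
    simp [← hmx]
  · rw [hmx, abs_le]
    exact ⟨hxs.1 i, hxs.2 i⟩

/-! ### Real matrices of quaternions -/

/-- The matrix with rows `(ξ, η)` and `(b η', ξ')` of `α = ξ + η Ω`, with real entries. -/
noncomputable def phiReal {a b : ℕ} (α : ℍ[ℚ,(a : ℚ),(b : ℚ)]) : Matrix (Fin 2) (Fin 2) ℝ :=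
  !![α.re + α.imI * √(a : ℝ), α.imJ + α.imK * √(a : ℝ);
     b * (α.imJ - α.imK * √(a : ℝ)), α.re - α.imI * √(a : ℝ)]

theorem map_phiReal {a b : ℕ} (α : ℍ[ℚ,(a : ℚ),(b : ℚ)]) :
    (phiReal α).map Complex.ofRealHom = phi α := by
  ext i j
  fin_cases i <;> fin_cases j <;> simp [phi, phiReal]

theorem phiReal_mul {a b : ℕ} (α β : ℍ[ℚ,(a : ℚ),(b : ℚ)]) :
    phiReal (α * β) = phiReal α * phiReal β := by
  apply Matrix.map_injective Complex.ofReal_injective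
  change (phiReal (α * β)).map Complex.ofRealHom =
    (phiReal α * phiReal β).map Complex.ofRealHom
  rw [Matrix.map_mul, map_phiReal, map_phiReal, map_phiReal, phi_mul]

theorem det_phiReal {a b : ℕ} (α : ℍ[ℚ,(a : ℚ),(b : ℚ)]) :
    (phiReal α).det = (qNorm α : ℝ) := by
  have h : (√(a : ℝ)) ^ 2 = a := Real.sq_sqrt (Nat.cast_nonneg a)
  rw [Matrix.det_fin_two, qNorm_eq]
  simp [phiReal]
  linear_combination (b * α.imK ^ 2 - α.imI ^ 2 : ℝ) * h

/-! ### Elements of given norm in an order -/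

/-- Up to right multiplication by elements of norm one, an order has finitely many elements of norm
`n ≠ 0`: if `β ≡ β₀` modulo `n R` have norm `n`, then `β₀⁻¹ β = β₀⁻¹ (β₀ + n γ) = 1 + star β₀ * γ`
lies in `R`. -/
theorem QuatOrder.exists_finite_norm_reps {a b : ℕ} (R : QuatOrder a b) {n : ℤ} (hn : n ≠ 0) :
    ∃ F : Set ℍ[ℚ,(a : ℚ),(b : ℚ)], F.Finite ∧ (∀ β ∈ F, qNorm β = n) ∧
      ∀ β ∈ R.toSubring, qNorm β = n →
        ∃ β₀ ∈ F, ∃ u ∈ R.toSubring, qNorm u = 1 ∧ β = β₀ * u := by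
  obtain ⟨e, -, he⟩ := R.generators
  have hmem : ∀ β : ℍ[ℚ,(a : ℚ),(b : ℚ)], β ∈ R.toSubring ↔
      ∃ m : Fin 4 → ℤ, ∑ i, m i • e i = β := by
    intro β
    rw [← Submodule.mem_span_range_iff_exists_fun, ← Submodule.mem_toAddSubgroup,
      Submodule.span_int_eq_addSubgroupClosure]
    exact Set.ext_iff.1 he β
  have : NeZero n.natAbs := ⟨Int.natAbs_ne_zero.2 hn⟩
  choose! m hm using fun β h => (hmem β).1 h
  let A : Set ℍ[ℚ,(a : ℚ),(b : ℚ)] := {β | β ∈ R.toSubring ∧ qNorm β = n}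
  -- `F` contains one element for each residue class modulo `n R` that meets `A`.
  obtain ⟨F, hFA, hF⟩ := Set.exists_subset_bijOn A
    (fun β (i : Fin 4) => (m β i : ZMod n.natAbs))
  refine ⟨F, hF.finite_iff_finite.2 (Set.toFinite _), fun β h => (hFA h).2, fun β hβ hβn => ?_⟩
  obtain ⟨β₀, hβ₀F, hβ₀⟩ := hF.surjOn ⟨β, ⟨hβ, hβn⟩, rfl⟩
  obtain ⟨hβ₀R, hβ₀n⟩ := hFA hβ₀F
  have hdvd : ∀ i, ∃ k : ℤ, m β i = m β₀ i + n * k := by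
    intro i
    have := congrFun hβ₀ i
    rw [ZMod.intCast_eq_intCast_iff_dvd_sub, Int.natAbs_dvd] at this
    obtain ⟨k, hk⟩ := this
    exact ⟨k, by linarith⟩
  choose k hk using hdvd
  let γ := ∑ i, k i • e i
  have hγ : γ ∈ R.toSubring := (hmem γ).2 ⟨k, rfl⟩
  have hβγ : β = β₀ + (n : ℚ) • γ := by
    have : ∑ i, m β i • e i = ∑ i, m β₀ i • e i + (n : ℚ) • γ := by
      simp only [γ, Finset.smul_sum, ← Finset.sum_add_distrib, hk, add_smul, mul_smul]
      simp [Int.cast_smul_eq_zsmul]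
    rwa [hm β hβ, hm β₀ hβ₀R] at this
  have hn' : (n : ℚ) ≠ 0 := by exact_mod_cast hn
  have hu : β = β₀ * (1 + star β₀ * γ) := by
    rw [mul_add, ← mul_assoc, mul_star_eq, hβ₀n, mul_one, hβγ, Algebra.smul_def]
  refine ⟨β₀, hβ₀F, 1 + star β₀ * γ,
    add_mem (one_mem _) (mul_mem (R.star_mem hβ₀R) hγ), ?_, hu⟩
  have := congrArg qNorm hu
  rw [qNorm_mul, hβn, hβ₀n] at this
  exact (mul_eq_left₀ hn').1 this.symm

/-! ### Bounded representatives modulo the units of an order -/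

/-- The matrix of `α ↦ phiReal α * g`, from the coordinates of `α` in the basis `1, ω, Ω, ωΩ` to
the entries read row by row. -/
noncomputable def coordMatrix (a b : ℕ) (g : Matrix (Fin 2) (Fin 2) ℝ) :
    Matrix (Fin 4) (Fin 4) ℝ :=
  !![g 0 0, √a * g 0 0, g 1 0, √a * g 1 0;
     g 0 1, √a * g 0 1, g 1 1, √a * g 1 1;
     g 1 0, -√a * g 1 0, b * g 0 0, -b * √a * g 0 0;
     g 1 1, -√a * g 1 1, b * g 0 1, -b * √a * g 0 1]

theorem det_coordMatrix (a b : ℕ) (g : Matrix (Fin 2) (Fin 2) ℝ) :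
    (coordMatrix a b g).det = 4 * a * b * g.det ^ 2 := by
  have h : (√(a : ℝ)) ^ 2 = a := Real.sq_sqrt (Nat.cast_nonneg a)
  rw [Matrix.det_fin_two]
  simp [coordMatrix, Matrix.det_succ_row_zero, Fin.sum_univ_succ, Fin.succAbove]
  linear_combination (4 * b * (g 0 0 * g 1 1 - g 0 1 * g 1 0) ^ 2 : ℝ) * h

theorem coordMatrix_mulVec {a b : ℕ} (g : Matrix (Fin 2) (Fin 2) ℝ)
    (α : ℍ[ℚ,(a : ℚ),(b : ℚ)]) :
    (coordMatrix a b g).mulVec ![(α.re : ℝ), α.imI, α.imJ, α.imK] =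
      ![(phiReal α * g) 0 0, (phiReal α * g) 0 1, (phiReal α * g) 1 0, (phiReal α * g) 1 1] := by
  ext i
  fin_cases i <;>
    simp [coordMatrix, phiReal, Matrix.mulVec, Matrix.mul_apply, dotProduct, Fin.sum_univ_succ] <;>
    ring

/-- The bound `c` does not depend on `g`, because the determinant of `α ↦ phiReal α * g` does not. -/
theorem QuatOrder.exists_mul_le {a b : ℕ} (ha : a ≠ 0) (hb : b ≠ 0) (R : QuatOrder a b) :
    ∃ c : ℝ, 0 ≤ c ∧ ∀ g : Matrix.SpecialLinearGroup (Fin 2) ℝ,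
      ∃ β ∈ R.toSubring, β ≠ 0 ∧ ∀ i j, |(phiReal β * g.1) i j| ≤ c := by
  obtain ⟨e, hli, he⟩ := R.generators
  let 𝓑 := QuaternionAlgebra.basisOneIJK (a : ℚ) 0 (b : ℚ)
  let E := 𝓑.toMatrix e
  have hE : E.det ≠ 0 := by
    have hspan : Submodule.span ℚ (Set.range e) = ⊤ :=
      hli.span_eq_top_of_card_eq_finrank (by rw [Module.finrank_eq_card_basis 𝓑])
    have := (Module.Basis.is_basis_iff_det 𝓑).1 ⟨hli, hspan⟩
    rw [Module.Basis.det_apply] at this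
    exact this.ne_zero
  let D : ℝ := 4 * a * b * E.det
  have hD : D ≠ 0 := by
    simp only [D]
    have : (E.det : ℝ) ≠ 0 := by exact_mod_cast hE
    positivity
  refine ⟨|D| + 1, by positivity, fun g => ?_⟩
  -- The entries of `phiReal (∑ j, m j • e j) * g` are the linear forms of `M` evaluated at `m`.
  let M := coordMatrix a b g.1 * E.map (Rat.castHom ℝ)
  have hM : M.det = D := by
    have : (E.map (Rat.castHom ℝ)).det = E.det := by
      rw [← RingHom.mapMatrix_apply, ← RingHom.map_det]
      simp
    rw [Matrix.det_mul, det_coordMatrix, g.2, this, one_pow, mul_one]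
  obtain ⟨m, hm0, hm⟩ := exists_int_linear_forms_le M (by rwa [hM]) (c := |D| + 1) (by positivity)
    (by
      rw [hM, Fintype.card_fin]
      exact (lt_add_one _).trans_le (le_self_pow₀ (by linarith [abs_nonneg D]) (by norm_num)))
  let β := ∑ j, m j • e j
  have hβ : M.mulVec (fun j => (m j : ℝ)) =
      ![(phiReal β * g.1) 0 0, (phiReal β * g.1) 0 1,
        (phiReal β * g.1) 1 0, (phiReal β * g.1) 1 1] := by
    rw [← coordMatrix_mulVec, ← Matrix.mulVec_mulVec]
    congr 1
    have key : ∀ i, (E.map (Rat.castHom ℝ)).mulVec (fun j => (m j : ℝ)) i =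
        ((𝓑.repr β i : ℚ) : ℝ) := by
      intro i
      simp [β, Matrix.mulVec, dotProduct, E, Module.Basis.toMatrix_apply, mul_comm,
        ← Int.cast_smul_eq_zsmul ℚ]
    ext i
    rw [key]
    fin_cases i <;> simp [𝓑]
  refine ⟨β, ?_, ?_, ?_⟩
  · change β ∈ R.carrier
    rw [he, SetLike.mem_coe, ← Submodule.span_int_eq_addSubgroupClosure, Submodule.mem_toAddSubgroup]
    exact Submodule.mem_span_range_iff_exists_fun ℤ |>.2 ⟨m, rfl⟩
  · intro h0
    apply hm0
    funext j
    have := Fintype.linearIndependent_iff.1 (hli.restrict_scalars' ℤ) m h0 j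
    simpa using this
  · simp only [hβ] at hm
    intro i j
    fin_cases i <;> fin_cases j
    exacts [hm 0, hm 1, hm 2, hm 3]

/-- Cocompactness of the group of elements of norm one of an order, in terms of matrix entries. -/
theorem QuatOrder.exists_unit_mul_le {a b : ℕ} [Fact b.Prime] (ha : a ≠ 0)
    (h : legendreSym b a = -1) (R : QuatOrder a b) :
    ∃ B : ℝ, ∀ g : Matrix.SpecialLinearGroup (Fin 2) ℝ,
      ∃ u ∈ R.toSubring, qNorm u = 1 ∧ ∀ i j, |(phiReal u * g.1) i j| ≤ B := by
  obtain ⟨c, hc0, hc⟩ := R.exists_mul_le ha (Fact.out : b.Prime).ne_zero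
  choose! F hFfin hFn hF using fun (n : ℤ) (hn : n ≠ 0) => R.exists_finite_norm_reps hn
  obtain ⟨N, hN⟩ := exists_nat_ge (2 * c ^ 2)
  let I : Set ℤ := {n | n ≠ 0 ∧ |n| ≤ N}
  have hI : I.Finite := (Set.finite_Icc (-(N : ℤ)) N).subset fun n hn => abs_le.1 hn.2
  have hfin : (⋃ n ∈ I, F n).Finite := hI.biUnion fun n hn => hFfin n hn.1
  obtain ⟨K, hK⟩ : ∃ K : ℝ, ∀ β ∈ ⋃ n ∈ I, F n, ∀ i j, |phiReal (star β) i j| ≤ K := by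
    obtain ⟨K, hK⟩ := (hfin.image fun β => ∑ i, ∑ j, |phiReal (star β) i j|).bddAbove
    refine ⟨K, fun β hβ i j => le_trans ?_ (hK ⟨β, hβ, rfl⟩)⟩
    exact (Finset.single_le_sum (f := fun j => |phiReal (star β) i j|)
      (fun _ _ => abs_nonneg _) (Finset.mem_univ j)).trans
      (Finset.single_le_sum (f := fun i => ∑ j, |phiReal (star β) i j|)
        (fun _ _ => Finset.sum_nonneg fun _ _ => abs_nonneg _) (Finset.mem_univ i))
  refine ⟨2 * (K * c), fun g => ?_⟩
  obtain ⟨β, hβR, hβ0, hβ⟩ := hc g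
  obtain ⟨n, hn⟩ := R.norm_int β hβR
  have hn0 : n ≠ 0 := by
    rintro rfl
    exact hβ0 (eq_zero_of_qNorm_eq_zero h (by simpa using hn))
  have hnN : |n| ≤ N := by
    have hdet : (phiReal β * g.1).det = n := by
      rw [Matrix.det_mul, g.2, det_phiReal, hn]
      simp
    have : |(n : ℝ)| ≤ N := by
      rw [← hdet, Matrix.det_fin_two]
      refine (abs_sub _ _).trans (le_trans ?_ hN)
      rw [abs_mul, abs_mul, two_mul, pow_two]
      gcongr <;> exact hβ _ _
    exact_mod_cast this
  obtain ⟨β₀, hβ₀, u, huR, hu, rfl⟩ := hF n hn0 β hβR hn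
  refine ⟨u, huR, hu, fun i j => ?_⟩
  have hn1 : (1 : ℝ) ≤ |(n : ℝ)| := by exact_mod_cast Int.one_le_abs hn0
  have hmul : (n : ℝ) • (phiReal u * g.1) = phiReal (star β₀) * (phiReal (β₀ * u) * g.1) := by
    rw [← Matrix.mul_assoc, ← phiReal_mul, ← mul_assoc, ← Matrix.smul_mul]
    congr 1
    have : star β₀ * β₀ = algebraMap ℚ _ (n : ℚ) := by
      have := mul_star_eq (star β₀)
      rwa [star_star, qNorm_star, hFn n hn0 β₀ hβ₀] at this
    rw [this, ← Algebra.smul_def]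
    ext i j
    fin_cases i <;> fin_cases j <;> simp [phiReal] <;> ring
  have hK' := hK β₀ (Set.mem_biUnion (show n ∈ I from ⟨hn0, hnN⟩) hβ₀)
  have hK0 : 0 ≤ K := (abs_nonneg _).trans (hK' 0 0)
  calc |(phiReal u * g.1) i j| ≤ |(n : ℝ)| * |(phiReal u * g.1) i j| :=
        le_mul_of_one_le_left (abs_nonneg _) hn1
    _ = |(phiReal (star β₀) * (phiReal (β₀ * u) * g.1)) i j| := by
        rw [← hmul, Matrix.smul_apply, smul_eq_mul, abs_mul]
    _ ≤ 2 * (K * c) := by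
        rw [Matrix.mul_apply, Fin.sum_univ_two, two_mul]
        refine (abs_add_le _ _).trans ?_
        rw [abs_mul, abs_mul]
        gcongr <;> first | exact hK' _ _ | exact hβ _ _

/-! ### The orbit of `j` under `SL(2, ℝ)` -/

/-- The inclusion of `SL(2, ℝ)` in `SL(2, ℂ)`. -/
noncomputable def realSL : Matrix.SpecialLinearGroup (Fin 2) ℝ →*
    Matrix.SpecialLinearGroup (Fin 2) ℂ :=
  Matrix.SpecialLinearGroup.map Complex.ofRealHom

theorem realSL_apply (g : Matrix.SpecialLinearGroup (Fin 2) ℝ) (i j : Fin 2) :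
    (realSL g).1 i j = (g.1 i j : ℂ) := rfl

/-- The point `j` of `H3`. -/
def H3.j : H3 := ⟨(0, 1), one_pos⟩

theorem den_realSL_j (g : Matrix.SpecialLinearGroup (Fin 2) ℝ) :
    den (realSL g) H3.j = g.1 1 0 ^ 2 + g.1 1 1 ^ 2 := by
  simp only [den, realSL_apply, H3.j, H3.z, H3.t, mul_zero, zero_add, Complex.normSq_ofReal]
  ring

theorem t_realSL_smul_j (g : Matrix.SpecialLinearGroup (Fin 2) ℝ) :
    (realSL g • H3.j).t = 1 / (g.1 1 0 ^ 2 + g.1 1 1 ^ 2) := by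
  rw [← den_realSL_j]
  rfl

theorem z_realSL_smul_j (g : Matrix.SpecialLinearGroup (Fin 2) ℝ) :
    (realSL g • H3.j).z =
      ((g.1 0 0 * g.1 1 0 + g.1 0 1 * g.1 1 1) / (g.1 1 0 ^ 2 + g.1 1 1 ^ 2) : ℝ) := by
  rw [← den_realSL_j]
  change (_ / _ : ℂ) = _
  simp only [realSL_apply, H3.j, H3.z, H3.t, mul_zero, zero_add, Complex.conj_ofReal]
  push_cast
  ring

/-- `SL(2, ℝ)` acts transitively on `P°`. -/
theorem exists_realSL_smul_j {x : H3} (hx : x ∈ realHalfPlane) :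
    ∃ g, realSL g • H3.j = x := by
  have ht := x.t_pos
  have hs : √x.t ≠ 0 := (Real.sqrt_pos.2 ht).ne'
  have hsq : √x.t ^ 2 = x.t := Real.sq_sqrt ht.le
  obtain ⟨g, hg⟩ : ∃ g : Matrix.SpecialLinearGroup (Fin 2) ℝ,
      g.1 = !![√x.t, x.z.re / √x.t; 0, 1 / √x.t] :=
    ⟨⟨_, by simp [Matrix.det_fin_two, hs]⟩, rfl⟩
  refine ⟨g, H3.ext' ?_ ?_⟩
  · rw [z_realSL_smul_j, hg]
    apply Complex.ext
    · rw [Complex.ofReal_re]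
      simp
      field_simp
    · exact hx.symm
  · rw [t_realSL_smul_j, hg]
    simp [hsq]

theorem isCompact_box {B : ℝ} (hB : 0 ≤ B) :
    IsCompact {x : H3 | x ∈ realHalfPlane ∧ x.z.re ^ 2 ≤ B ^ 2 ∧ 1 ≤ B * x.t ∧ x.t ≤ B} := by
  have himage : Subtype.val ''
      {x : H3 | x ∈ realHalfPlane ∧ x.z.re ^ 2 ≤ B ^ 2 ∧ 1 ≤ B * x.t ∧ x.t ≤ B} =
      {p : ℂ × ℝ | p.1.im = 0 ∧ p.1.re ^ 2 ≤ B ^ 2 ∧ 1 ≤ B * p.2 ∧ p.2 ≤ B} := by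
    ext p
    refine ⟨?_, fun hp => ?_⟩
    · rintro ⟨x, hx, rfl⟩
      exact hx
    · have hp2 : 0 < p.2 := pos_of_mul_pos_right (one_pos.trans_le hp.2.2.1) hB
      exact ⟨⟨p, hp2⟩, hp, rfl⟩
  refine Subtype.isCompact_iff.2 ((congrArg IsCompact himage).mpr ?_)
  refine ((isCompact_closedBall (0 : ℂ) B).prod (isCompact_Icc (a := 0) (b := B))).of_isClosed_subset
    ?_ ?_
  · have h1 : IsClosed {p : ℂ × ℝ | p.1.im = 0} := isClosed_eq (by fun_prop) (by fun_prop)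
    have h2 : IsClosed {p : ℂ × ℝ | p.1.re ^ 2 ≤ B ^ 2} :=
      isClosed_le (by fun_prop) (by fun_prop)
    have h3 : IsClosed {p : ℂ × ℝ | 1 ≤ B * p.2} := isClosed_le (by fun_prop) (by fun_prop)
    have h4 : IsClosed {p : ℂ × ℝ | p.2 ≤ B} := isClosed_le (by fun_prop) (by fun_prop)
    exact h1.inter (h2.inter (h3.inter h4))
  · rintro ⟨z, t⟩ ⟨h1, h2, h3, h4⟩
    refine ⟨?_, (pos_of_mul_pos_right (one_pos.trans_le h3) hB).le, h4⟩
    rw [mem_closedBall_zero_iff]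
    refine (Complex.norm_le_abs_re_add_abs_im z).trans ?_
    simp only at h1 h2
    rw [h1, abs_zero, add_zero]
    exact abs_le_of_sq_le_sq h2 hB

/-- A bounded set of unimodular matrices moves `j` within a compact part of `P°`. -/
theorem realSL_smul_j_mem_box {B : ℝ} (g : Matrix.SpecialLinearGroup (Fin 2) ℝ)
    (hg : ∀ i j, |g.1 i j| ≤ B) :
    realSL g • H3.j ∈ realHalfPlane ∧ (realSL g • H3.j).z.re ^ 2 ≤ (2 * B ^ 2) ^ 2 ∧
      1 ≤ 2 * B ^ 2 * (realSL g • H3.j).t ∧ (realSL g • H3.j).t ≤ 2 * B ^ 2 := by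
  have hdet := g.2
  rw [Matrix.det_fin_two] at hdet
  have hsq : ∀ i j, g.1 i j ^ 2 ≤ B ^ 2 := fun i j =>
    sq_le_sq' (abs_le.1 (hg i j)).1 (abs_le.1 (hg i j)).2
  have h0 := hsq 0 0
  have h1 := hsq 0 1
  have h2 := hsq 1 0
  have h3 := hsq 1 1
  rw [t_realSL_smul_j]
  refine ⟨by simp [realHalfPlane, z_realSL_smul_j, -Complex.ofReal_div], ?_, ?_, ?_⟩
  all_goals try rw [z_realSL_smul_j, Complex.ofReal_re]
  all_goals
    generalize g.1 0 0 = p at *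
    generalize g.1 0 1 = q at *
    generalize g.1 1 0 = r at *
    generalize g.1 1 1 = s at *
    have hH : 0 < r ^ 2 + s ^ 2 := by
      by_contra! hc
      obtain rfl : r = 0 := by nlinarith
      obtain rfl : s = 0 := by nlinarith
      simp at hdet
    -- Lagrange's identity bounds the lower row from below.
    have hL : (p ^ 2 + q ^ 2) * (r ^ 2 + s ^ 2) = (p * r + q * s) ^ 2 + 1 := by
      linear_combination (p * s - q * r + 1) * hdet
    have hLB : (p * r + q * s) ^ 2 + 1 ≤ 2 * B ^ 2 * (r ^ 2 + s ^ 2) := by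
      rw [← hL]
      exact mul_le_mul_of_nonneg_right (by linarith) hH.le
  · have h1 : 1 ≤ 2 * B ^ 2 * (r ^ 2 + s ^ 2) := by nlinarith [sq_nonneg (p * r + q * s)]
    rw [div_pow, div_le_iff₀ (by positivity), ← mul_pow]
    nlinarith
  · rw [mul_one_div, one_le_div hH]
    linarith
  · rw [div_le_iff₀ hH]
    nlinarith [sq_nonneg (p * r + q * s)]

/-! ### Compactness of the projection of `P°` -/

/-- An element of norm one as an element of `SL(2, ℝ)`. -/
noncomputable def unitSL {a b : ℕ} (u : ℍ[ℚ,(a : ℚ),(b : ℚ)]) (hu : qNorm u = 1) :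
    Matrix.SpecialLinearGroup (Fin 2) ℝ :=
  ⟨phiReal u, by rw [det_phiReal, hu, Rat.cast_one]⟩

theorem QuatOrder.mem_Gamma_iff {a b : ℕ} (R : QuatOrder a b)
    {γ : Matrix.SpecialLinearGroup (Fin 2) ℂ} :
    γ ∈ R.Gamma ↔ ∃ u ∈ R.toSubring, ∃ hu : qNorm u = 1, γ = realSL (unitSL u hu) := by
  constructor
  · rintro ⟨u, huR, hu, huγ⟩
    exact ⟨u, huR, hu, Subtype.ext (huγ.symm.trans (map_phiReal u).symm)⟩
  · rintro ⟨u, huR, hu, rfl⟩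
    exact ⟨u, huR, hu, (map_phiReal u).symm⟩

theorem QuatOrder.proj_smul {a b : ℕ} (R : QuatOrder a b)
    {γ : Matrix.SpecialLinearGroup (Fin 2) ℂ} (hγ : γ ∈ R.Gamma) (x : H3) :
    R.proj (γ • x) = R.proj x :=
  Quotient.sound (s := MulAction.orbitRel R.Gamma H3) ⟨⟨γ, hγ⟩, rfl⟩

theorem QuatOrder.continuous_proj {a b : ℕ} (R : QuatOrder a b) : Continuous R.proj :=
  continuous_quotient_mk'

theorem QuatOrder.isCompact_proj_realHalfPlane {a b : ℕ} [Fact b.Prime] (ha : a ≠ 0)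
    (h : legendreSym b a = -1) (R : QuatOrder a b) : IsCompact (R.proj '' realHalfPlane) := by
  obtain ⟨B, hB⟩ := R.exists_unit_mul_le ha h
  have himage : R.proj '' realHalfPlane = R.proj '' {x : H3 | x ∈ realHalfPlane ∧
      x.z.re ^ 2 ≤ (2 * B ^ 2) ^ 2 ∧ 1 ≤ 2 * B ^ 2 * x.t ∧ x.t ≤ 2 * B ^ 2} := by
    refine subset_antisymm ?_ (Set.image_mono fun x hx => hx.1)
    rintro _ ⟨x, hx, rfl⟩
    obtain ⟨g, rfl⟩ := exists_realSL_smul_j hx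
    obtain ⟨u, hu, hn, hug⟩ := hB g
    refine ⟨_, ?_, R.proj_smul (R.mem_Gamma_iff.2 ⟨u, hu, hn, rfl⟩) _⟩
    rw [← mul_smul, ← map_mul]
    exact realSL_smul_j_mem_box _ hug
  rw [himage]
  exact (isCompact_box (by positivity)).image R.continuous_proj

/-! ### The distance to `P°` on an itgs with compact projection -/

/-- `Im z / t` at the point `z + t j`: `sinh` of its signed hyperbolic distance to `P°`. -/
noncomputable def slope (x : H3) : ℝ := x.z.im / x.t

theorem continuous_slope : Continuous slope := by
  refine Continuous.div ?_ ?_ fun x => x.t_pos.ne'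
  · exact Complex.continuous_im.comp (continuous_fst.comp continuous_subtype_val)
  · exact continuous_snd.comp continuous_subtype_val

theorem slope_realSL_smul (g : Matrix.SpecialLinearGroup (Fin 2) ℝ) (x : H3) :
    slope (realSL g • x) = slope x := by
  have hD := (den_pos (realSL g) x).ne'
  have ht := x.t_pos.ne'
  have hdet := g.2
  rw [Matrix.det_fin_two] at hdet
  have hz : (realSL g • x).z.im = x.z.im / den (realSL g) x := by
    change (_ / _ : ℂ).im = _
    rw [Complex.div_ofReal_im]
    congr 1
    simp only [realSL_apply, ← Complex.ofReal_pow, Complex.add_im, Complex.mul_im, Complex.add_re,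
      Complex.mul_re, Complex.conj_re, Complex.conj_im, Complex.ofReal_re, Complex.ofReal_im]
    linear_combination x.z.im * hdet
  have ht' : (realSL g • x).t = x.t / den (realSL g) x := rfl
  rw [slope, hz, ht', slope]
  field_simp

theorem QuatOrder.exists_abs_slope_le {a b : ℕ} (R : QuatOrder a b) {S : Set H3}
    (hS : IsCompact (R.proj '' S)) : ∃ C, ∀ x ∈ S, |x.z.im| ≤ C * x.t := by
  have hinv : ∀ x y : H3, MulAction.orbitRel R.Gamma H3 x y → slope x = slope y := by
    rintro _ y ⟨⟨γ, hγ⟩, rfl⟩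
    obtain ⟨u, -, hu, rfl⟩ := R.mem_Gamma_iff.1 hγ
    exact slope_realSL_smul _ y
  let f : R.X → ℝ := Quotient.lift slope hinv
  have hf : Continuous f := continuous_slope.quotient_lift hinv
  obtain ⟨C, hC⟩ := (hS.image hf).isBounded.exists_norm_le
  refine ⟨C, fun x hx => ?_⟩
  have : |x.z.im / x.t| ≤ C := hC _ ⟨_, ⟨x, hx, rfl⟩, rfl⟩
  rwa [abs_div, abs_of_pos x.t_pos, div_le_iff₀ x.t_pos] at this

theorem eq_zero_of_forall_abs_le_mul {y C : ℝ} (h : ∀ t > 0, |y| ≤ C * t) : y = 0 := by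
  by_contra hy
  have hy' := abs_pos.2 hy
  have h1 := h (|y| / (2 * (|C| + 1))) (by positivity)
  have h2 : C * (|y| / (2 * (|C| + 1))) ≤ (|C| + 1) * (|y| / (2 * (|C| + 1))) := by
    gcongr
    linarith [le_abs_self C]
  have h3 : (|C| + 1) * (|y| / (2 * (|C| + 1))) = |y| / 2 := by
    field_simp
  linarith

theorem halfPlane_eq_realHalfPlane {p v : ℂ} (hv : v ≠ 0) {C : ℝ}
    (hC : ∀ x ∈ halfPlane p v, |x.z.im| ≤ C * x.t) : halfPlane p v = realHalfPlane := by
  -- The points of the half-plane over `p + s v` have arbitrarily small height.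
  have him : ∀ s : ℝ, p.im + s * v.im = 0 := by
    intro s
    refine eq_zero_of_forall_abs_le_mul (C := C) fun t ht => ?_
    have := hC ⟨(p + s * v, t), ht⟩ ⟨s, rfl⟩
    simpa [H3.z, H3.t] using this
  have hp : p.im = 0 := by simpa using him 0
  have hvim : v.im = 0 := by simpa [hp] using him 1
  have hvre : v.re ≠ 0 := fun h => hv (Complex.ext h hvim)
  ext x
  refine ⟨?_, fun hx => ⟨(x.z.re - p.re) / v.re, ?_⟩⟩
  · rintro ⟨s, hs⟩
    change x.z.im = 0
    simp [hs, hp, hvim]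
  · apply Complex.ext
    · simp only [Complex.add_re, Complex.re_ofReal_mul]
      field_simp
      ring
    · simpa [hp, hvim] using show x.z.im = 0 from hx

/-- At each height `t < r` the half-sphere has two points over the vertical line through `c`, at
distance `2 √(r² - t²)` from each other; their distances to the real axis cannot both be `O(t)`. -/
theorem not_forall_halfSphere_le {c : ℂ} {r : ℝ} (hr : 0 < r) (C : ℝ) :
    ¬ ∀ x ∈ halfSphere c r, |x.z.im| ≤ C * x.t := by
  intro h
  have hC : 0 < √(C ^ 2 + 2) := Real.sqrt_pos.2 (by positivity)
  have hCsq : √(C ^ 2 + 2) ^ 2 = C ^ 2 + 2 := Real.sq_sqrt (by positivity)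
  -- At this height, `r² - t² = (C² + 1) t²` exceeds `(C t)²`.
  let t := r / √(C ^ 2 + 2)
  have ht : 0 < t := by positivity
  have htr : r ^ 2 = (C ^ 2 + 2) * t ^ 2 := by
    simp only [t, div_pow, hCsq]
    field_simp
  let q := √(r ^ 2 - t ^ 2)
  have hq : q ^ 2 = r ^ 2 - t ^ 2 :=
    Real.sq_sqrt (by rw [htr]; nlinarith [sq_nonneg (C * t), sq_nonneg t])
  have hmem : ∀ s : ℝ, s ^ 2 = r ^ 2 - t ^ 2 → |c.im + s| ≤ C * t := by
    intro s hs
    have := h ⟨(c + s * Complex.I, t), ht⟩ (by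
      change ‖c + s * Complex.I - c‖ ^ 2 + t ^ 2 = r ^ 2
      simp [hs])
    simpa [H3.z, H3.t] using this
  have h1 := (abs_le.1 (hmem q hq)).2
  have h2 := (abs_le.1 (hmem (-q) (by rw [neg_sq, hq]))).1
  have hq0 : 0 ≤ q := Real.sqrt_nonneg _
  have h3 : q ≤ C * t := by linarith
  have h4 : q ^ 2 ≤ (C * t) ^ 2 := pow_le_pow_left₀ hq0 h3 2
  nlinarith [pow_pos ht 2]

theorem isItgs_realHalfPlane : IsItgs realHalfPlane := by
  refine Or.inl ⟨0, 1, one_ne_zero, Set.ext fun x => ⟨fun hx => ⟨x.z.re, ?_⟩, ?_⟩⟩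
  · exact Complex.ext (by simp) (by simpa using show x.z.im = 0 from hx)
  · rintro ⟨s, hs⟩
    change x.z.im = 0
    simp [hs]

end QuatHyp

theorem mainTheorem8 (a b : ℕ) [Fact b.Prime] (h : QuatHyp.IsK1S a b)
    (R : QuatHyp.QuatOrder a b) :
    (∀ S : Set QuatHyp.H3, R.IsClosedFor S ↔ S = QuatHyp.realHalfPlane) ∧
      IsCompact (R.proj '' QuatHyp.realHalfPlane) := by
  have hcompact := R.isCompact_proj_realHalfPlane h.a_pos.ne' h.legendre_a
  refine ⟨fun S => ⟨?_, ?_⟩, hcompact⟩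
  · rintro ⟨hS, hSc⟩
    obtain ⟨C, hC⟩ := R.exists_abs_slope_le hSc
    rcases hS with ⟨p, v, hv, rfl⟩ | ⟨c, r, hr, rfl⟩
    · exact QuatHyp.halfPlane_eq_realHalfPlane hv hC
    · exact absurd hC (QuatHyp.not_forall_halfSphere_le hr C)
  · rintro rfl
    exact ⟨QuatHyp.isItgs_realHalfPlane, hcompact⟩
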